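/- Let $\mathcal M$ be a preadditive braided monoidal category that has equalizers, denumerable coproducts and coequalizers of reflexive pairs, and whose tensor products are additive in each variable and preserve equalizers, denumerable coproducts and coequalizers of reflexive pairs (in each variable). Let $\mathrm{Alg}(\mathcal M)$ be the category of algebras (monoids) in $\mathcal M$, $\Omega:\mathrm{Alg}(\mathcal M)\to\mathcal M$ the forgetful functor and $T\dashv\Omega$ its left adjoint, the tensor algebra functor: $\Omega TV=\bigoplus_{n\ge 0}V^{\otimes n}$ with canonical inclusions $\alpha_nV:V^{\otimes n}\to\Omega TV$, unit $\eta V=\alpha_1V$, and counit $\epsilon$ given on $A^{\otimes n}$ by the iterated multiplication of the algebra $A$. Let $\omega:\Omega T\to\mathrm{Id}$ be the projection onto degree one, $\omega V\circ\alpha_nV=\delta_{n,1}\mathrm{Id}_V$. Let $\mathrm{Alg}^+(\mathcal M)=\mathrm{Alg}(\mathcal M)/\mathbf 1$ be the category of augmented algebras $(A,\varepsilon:A\to\mathbf 1)$ and $U:\mathrm{Alg}^+(\mathcal M)\to\mathrm{Alg}(\mathcal M)$ the forgetful functor. Let $T^+V=(TV,\varepsilon_{TV})$, where $\varepsilon_{TV}$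 is the algebra morphism that vanishes on $V$, and let $\Omega^+(A,\varepsilon)=\mathrm{Ker}(\Omega\varepsilon)$ with inclusion $kA:\Omega^+(A,\varepsilon)\to\Omega A$. Then $T^+\dashv\Omega^+$, with unit $\eta^+$ and counit $\epsilon^+$ determined by $kTV\circ\eta^+V=\eta V$ and $U\epsilon^+(A,\varepsilon)=\epsilon A\circ TkA$. As $UT^+=T$, one can define $$\zeta:=\big(\Omega^+\xrightarrow{\ \eta\Omega^+\ }\Omega T\Omega^+=\Omega UT^+\Omega^+\xrightarrow{\ \Omega U\epsilon^+\ }\Omega U\big).$$ An augmentation of a monad $(M,m,u)$ is a natural transformation $\gamma:M\to\mathrm{Id}$ with $\gamma\circ u=\mathrm{Id}$ and $\gamma\circ m=\gamma\gamma$. A functor $L:\mathcal B\to\mathcal A$ is h-separable if there are maps $P_{X,Y}:\mathrm{Hom}(LX,LY)\to\mathrm{Hom}(X,Y)$, natural in $X$ and $Y$, with $P_{X,Y}(Lf)=f$ and $P_{X,Z}(g\circ f)=P_{Y,Z}(g)\circ P_{X,Y}(f)$ for all $f:LX\to LY$ and $g:LY\to LZ$. Then: 1. $\zeta T^+:\Omega^+T^+\to\Omega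 T$ is a morphism of monads from the monad of $T^+\dashv\Omega^+$ to the monad of $T\dashv\Omega$. 2. $\omega^+:=\omega\circ\zeta T^+:\Omega^+T^+\to\mathrm{Id}$ is an augmentation of the monad $(\Omega^+T^+,\Omega^+\epsilon^+T^+,\eta^+)$. 3. Equivalently, $T^+$ is h-separable. The equivalence is the following: a natural transformation $\gamma:\Omega^+T^+\to\mathrm{Id}$ is an augmentation of this monad if and only if the maps $P_{X,Y}(f)=\gamma Y\circ\Omega^+f\circ\eta^+X$, for $f:T^+X\to T^+Y$, make $T^+$ h-separable in the above sense. -/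

import Mathlib

open CategoryTheory MonoidalCategory Limits

noncomputable section

namespace TensorAlg

universe v u

set_option linter.unusedSectionVars false

/-! ### Maps out of tensor products with countable coproducts -/

section Coprod

variable {C : Type u} [Category.{v} C] [MonoidalCategory C] [HasCoproductsOfShape ℕ C]

/-- The morphism `X ⊗ ∐ F ⟶ Z` given by its components on `X ⊗ F n`. -/
def descL [∀ X : C, PreservesColimitsOfShape (Discrete ℕ) (tensorLeft X)]
    {X Z : C} {F : ℕ → C} (f : ∀ n, X ⊗ F n ⟶ Z) : X ⊗ (∐ F) ⟶ Z :=
  (PreservesCoproduct.iso (tensorLeft X) F).hom ≫ Sigma.desc f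

/-- The morphism `(∐ F) ⊗ X ⟶ Z` given by its components on `F n ⊗ X`. -/
def descR [∀ X : C, PreservesColimitsOfShape (Discrete ℕ) (tensorRight X)]
    {X Z : C} {F : ℕ → C} (f : ∀ n, F n ⊗ X ⟶ Z) : (∐ F) ⊗ X ⟶ Z :=
  (PreservesCoproduct.iso (tensorRight X) F).hom ≫ Sigma.desc f

theorem ι_descL [∀ X : C, PreservesColimitsOfShape (Discrete ℕ) (tensorLeft X)]
    {X Z : C} {F : ℕ → C} (f : ∀ n, X ⊗ F n ⟶ Z) (n : ℕ) :
    X ◁ Sigma.ι F n ≫ descL f = f n := by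
  have h : X ◁ Sigma.ι F n = Sigma.ι (fun j => X ⊗ F j) n ≫
      (PreservesCoproduct.iso (tensorLeft X) F).inv := by
    rw [PreservesCoproduct.inv_hom]
    exact (ι_comp_sigmaComparison (tensorLeft X) F n).symm
  rw [h, descL, Category.assoc, Iso.inv_hom_id_assoc, Sigma.ι_desc]

theorem ι_descR [∀ X : C, PreservesColimitsOfShape (Discrete ℕ) (tensorRight X)]
    {X Z : C} {F : ℕ → C} (f : ∀ n, F n ⊗ X ⟶ Z) (n : ℕ) :
    Sigma.ι F n ▷ X ≫ descR f = f n := by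
  have h : Sigma.ι F n ▷ X = Sigma.ι (fun j => F j ⊗ X) n ≫
      (PreservesCoproduct.iso (tensorRight X) F).inv := by
    rw [PreservesCoproduct.inv_hom]
    exact (ι_comp_sigmaComparison (tensorRight X) F n).symm
  rw [h, descR, Category.assoc, Iso.inv_hom_id_assoc, Sigma.ι_desc]

theorem extL [∀ X : C, PreservesColimitsOfShape (Discrete ℕ) (tensorLeft X)]
    {X Z : C} {F : ℕ → C} {f g : X ⊗ (∐ F) ⟶ Z}
    (h : ∀ n, X ◁ Sigma.ι F n ≫ f = X ◁ Sigma.ι F n ≫ g) : f = g := by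
  rw [← cancel_epi (PreservesCoproduct.iso (tensorLeft X) F).inv]
  refine Sigma.hom_ext _ _ fun n => ?_
  have := ι_comp_sigmaComparison (tensorLeft X) F n
  rw [PreservesCoproduct.inv_hom, ← Category.assoc, ← Category.assoc, this]
  exact h n

theorem extR [∀ X : C, PreservesColimitsOfShape (Discrete ℕ) (tensorRight X)]
    {X Z : C} {F : ℕ → C} {f g : (∐ F) ⊗ X ⟶ Z}
    (h : ∀ n, Sigma.ι F n ▷ X ≫ f = Sigma.ι F n ▷ X ≫ g) : f = g := by
  rw [← cancel_epi (PreservesCoproduct.iso (tensorRight X) F).inv]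
  refine Sigma.hom_ext _ _ fun n => ?_
  have := ι_comp_sigmaComparison (tensorRight X) F n
  rw [PreservesCoproduct.inv_hom, ← Category.assoc, ← Category.assoc, this]
  exact h n

theorem extLR [∀ X : C, PreservesColimitsOfShape (Discrete ℕ) (tensorLeft X)]
    [∀ X : C, PreservesColimitsOfShape (Discrete ℕ) (tensorRight X)]
    {X Y Z : C} {F : ℕ → C} {f g : X ⊗ ((∐ F) ⊗ Y) ⟶ Z}
    (h : ∀ n, X ◁ (Sigma.ι F n ▷ Y) ≫ f = X ◁ (Sigma.ι F n ▷ Y) ≫ g) : f = g := by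
  rw [← cancel_epi (X ◁ (PreservesCoproduct.iso (tensorRight Y) F).inv)]
  refine extL fun n => ?_
  have := ι_comp_sigmaComparison (tensorRight Y) F n
  rw [PreservesCoproduct.inv_hom, ← Category.assoc, ← Category.assoc,
    ← MonoidalCategory.whiskerLeft_comp, this]
  exact h n

end Coprod

/-! ### Tensor powers and the tensor algebra -/

section Powers

variable {C : Type u} [Category.{v} C] [MonoidalCategory C]

/-- The tensor power `V^{⊗ n}`, bracketed to the left: `V^{⊗ 0} = 𝟙_` and
`V^{⊗ (n+1)} = V^{⊗ n} ⊗ V`; so `V^{⊗ 1} = 𝟙_ ⊗ V`, identified with `V` by the left unitor. -/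
def tpow (V : C) : ℕ → C
  | 0 => 𝟙_ C
  | n + 1 => tpow V n ⊗ V

/-- The canonical isomorphism (written as a morphism) `V^{⊗ m} ⊗ V^{⊗ n} ⟶ V^{⊗ (m+n)}`. -/
def concat (V : C) (m : ℕ) : ∀ n : ℕ, tpow V m ⊗ tpow V n ⟶ tpow V (m + n)
  | 0 => (ρ_ (tpow V m)).hom
  | n + 1 => (α_ (tpow V m) (tpow V n) V).inv ≫ concat V m n ▷ V

/-- The tensor power `f^{⊗ n}` of a morphism. -/
def tpowMap {V W : C} (f : V ⟶ W) : ∀ n : ℕ, tpow V n ⟶ tpow W n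
  | 0 => 𝟙 (𝟙_ C)
  | n + 1 => tpowMap f n ⊗ₘ f

/-- For a morphism `f : V ⟶ A` to an algebra, the morphism `V^{⊗ n} ⟶ A` that is `f^{⊗ n}`
followed by the `n`-fold multiplication of `A`. -/
def powLift {V : C} (A : C) [MonObj A] (f : V ⟶ A) : ∀ n : ℕ, tpow V n ⟶ A
  | 0 => MonObj.one
  | n + 1 => (powLift A f n ⊗ₘ f) ≫ MonObj.mul

/-- The projection of the tensor powers onto degree one: the identity of `V` (up to the
unitor) in degree one, and zero in all other degrees. -/
def powProj [HasZeroMorphisms C] (V : C) : ∀ n : ℕ, tpow V n ⟶ V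
  | 1 => (λ_ V).hom
  | _ => 0

end Powers

section TensorAlgebra

variable {C : Type u} [Category.{v} C] [MonoidalCategory C] [HasCoproductsOfShape ℕ C]

/-- The object `ΩTV = ⨁ₙ V^{⊗ n}` underlying the tensor algebra. -/
def tens (V : C) : C := ∐ (tpow V)

/-- The canonical inclusion `αₙ : V^{⊗ n} ⟶ ΩTV`. -/
def incl (V : C) (n : ℕ) : tpow V n ⟶ tens V := Sigma.ι (tpow V) n

/-- The inclusion of degree zero. -/
def inclZero (V : C) : 𝟙_ C ⟶ tens V := incl V 0

/-- The inclusion `αₙ₊₁`, with domain written as `V^{⊗ n} ⊗ V`. -/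
def inclSucc (V : C) (n : ℕ) : tpow V n ⊗ V ⟶ tens V := incl V (n + 1)

/-- The inclusion `α₁`, with domain written as `𝟙_ ⊗ V`. -/
def inclUnitor (V : C) : 𝟙_ C ⊗ V ⟶ tens V := incl V 1

/-- The inclusion `V ⟶ ΩTV` of degree one. -/
def inclOne (V : C) : V ⟶ tens V := (λ_ V).inv ≫ inclUnitor V

/-- The projection `ΩTV ⟶ V` onto degree one. -/
def projOne [HasZeroMorphisms C] (V : C) : tens V ⟶ V := Sigma.desc (powProj V)

/-- The morphism `ΩTV ⟶ A` induced by a morphism `f : V ⟶ A` to an algebra. -/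
def liftHom {V : C} (A : C) [MonObj A] (f : V ⟶ A) : tens V ⟶ A := Sigma.desc (powLift A f)

theorem incl_liftHom {V : C} (A : C) [MonObj A] (f : V ⟶ A) (n : ℕ) :
    incl V n ≫ liftHom A f = powLift A f n := Sigma.ι_desc _ _

theorem inclZero_liftHom {V : C} (A : C) [MonObj A] (f : V ⟶ A) :
    inclZero V ≫ liftHom A f = MonObj.one := incl_liftHom A f 0

theorem inclSucc_liftHom {V : C} (A : C) [MonObj A] (f : V ⟶ A) (n : ℕ) :
    inclSucc V n ≫ liftHom A f = ((incl V n ≫ liftHom A f) ⊗ₘ f) ≫ MonObj.mul := by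
  rw [incl_liftHom]
  exact incl_liftHom A f (n + 1)

theorem tens_ext {V Z : C} {f g : tens V ⟶ Z} (h : ∀ n, incl V n ≫ f = incl V n ≫ g) : f = g :=
  Sigma.hom_ext _ _ h

variable [∀ X : C, PreservesColimitsOfShape (Discrete ℕ) (tensorLeft X)]
  [∀ X : C, PreservesColimitsOfShape (Discrete ℕ) (tensorRight X)]

/-- The multiplication of the tensor algebra: concatenation of tensor powers. -/
def tmul (V : C) : tens V ⊗ tens V ⟶ tens V :=
  descL fun n => descR fun m => concat V m n ≫ incl V (m + n)

theorem incl_incl_tmul (V : C) (m n : ℕ) :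
    incl V m ▷ tpow V n ≫ tens V ◁ incl V n ≫ tmul V = concat V m n ≫ incl V (m + n) := by
  have h1 := ι_descL (fun n => descR fun m => concat V m n ≫ incl V (m + n)) n
  have h2 := ι_descR (fun m => concat V m n ≫ incl V (m + n)) m
  exact (congrArg (fun t => incl V m ▷ tpow V n ≫ t) h1).trans h2

/-- Right multiplication by `V`. -/
def tstep (V : C) : tens V ⊗ V ⟶ tens V := descR fun n => inclSucc V n

theorem incl_tstep (V : C) (n : ℕ) : incl V n ▷ V ≫ tstep V = inclSucc V n :=
  ι_descR (fun n => inclSucc V n) n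

theorem incl_zero_tmul (V : C) : tens V ◁ inclZero V ≫ tmul V = (ρ_ (tens V)).hom := by
  refine extR fun m => ?_
  refine (incl_incl_tmul V m 0).trans ?_
  exact (rightUnitor_naturality (incl V m)).symm

theorem incl_succ_tmul (V : C) (n : ℕ) : tens V ◁ inclSucc V n ≫ tmul V =
    (α_ (tens V) (tpow V n) V).inv ≫ (tens V ◁ incl V n ≫ tmul V) ▷ V ≫ tstep V := by
  refine extR fun m => ?_
  refine (incl_incl_tmul V m (n + 1)).trans ?_
  have h1 : incl V m ▷ (tpow V n ⊗ V) ≫ (α_ (tens V) (tpow V n) V).inv =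
      (α_ _ _ _).inv ≫ (incl V m ▷ tpow V n) ▷ V := by simp
  change _ = incl V m ▷ (tpow V n ⊗ V) ≫ _
  rw [← Category.assoc (incl V m ▷ (tpow V n ⊗ V)), h1, Category.assoc,
    ← comp_whiskerRight_assoc, incl_incl_tmul, comp_whiskerRight_assoc, incl_tstep]
  refine (Category.assoc _ _ _).trans ?_
  rfl

theorem tstep_tmul (V : C) : tens V ◁ tstep V ≫ tmul V =
    (α_ (tens V) (tens V) V).inv ≫ tmul V ▷ V ≫ tstep V := by
  refine extLR fun n => ?_
  change tens V ◁ (incl V n ▷ V) ≫ _ = tens V ◁ (incl V n ▷ V) ≫ _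
  rw [← MonoidalCategory.whiskerLeft_comp_assoc, incl_tstep, incl_succ_tmul]
  simp

theorem whiskerLeft_inclOne_tmul (V : C) : tens V ◁ inclOne V ≫ tmul V = tstep V := by
  have h : tens V ◁ inclUnitor V ≫ tmul V = (α_ (tens V) (𝟙_ C) V).inv ≫
      (tens V ◁ inclZero V ≫ tmul V) ▷ V ≫ tstep V := incl_succ_tmul V 0
  rw [inclOne, MonoidalCategory.whiskerLeft_comp, Category.assoc, h, incl_zero_tmul]
  simp

theorem inclSucc_eq (V : C) (n : ℕ) : inclSucc V n = (incl V n ⊗ₘ inclOne V) ≫ tmul V := by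
  rw [MonoidalCategory.tensorHom_def, Category.assoc, whiskerLeft_inclOne_tmul, incl_tstep]

theorem tens_one_mul (V : C) : inclZero V ▷ tens V ≫ tmul V = (λ_ (tens V)).hom := by
  refine extL fun n => ?_
  change 𝟙_ C ◁ incl V n ≫ inclZero V ▷ tens V ≫ tmul V = 𝟙_ C ◁ incl V n ≫ _
  rw [leftUnitor_naturality]
  induction n with
  | zero =>
    change 𝟙_ C ◁ inclZero V ≫ inclZero V ▷ tens V ≫ tmul V = (λ_ (𝟙_ C)).hom ≫ inclZero V
    rw [whisker_exchange_assoc, incl_zero_tmul, rightUnitor_naturality, unitors_equal]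
  | succ n ih =>
    change 𝟙_ C ◁ inclSucc V n ≫ inclZero V ▷ tens V ≫ tmul V =
      (λ_ (tpow V n ⊗ V)).hom ≫ inclSucc V n
    rw [← incl_tstep]
    rw [whisker_exchange_assoc, MonoidalCategory.whiskerLeft_comp, Category.assoc, tstep_tmul]
    have : inclZero V ▷ (tpow V n ⊗ V) ≫ tens V ◁ incl V n ▷ V ≫ (α_ _ _ _).inv ≫
        tmul V ▷ V ≫ tstep V = (α_ (𝟙_ C) (tpow V n) V).inv ≫
          (𝟙_ C ◁ incl V n ≫ inclZero V ▷ tens V ≫ tmul V) ▷ V ≫ tstep V := by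
      rw [whisker_exchange_assoc]
      simp
    refine this.trans ?_
    rw [ih]
    simp

theorem tens_mul_assoc (V : C) : tmul V ▷ tens V ≫ tmul V =
    (α_ (tens V) (tens V) (tens V)).hom ≫ tens V ◁ tmul V ≫ tmul V := by
  refine extL fun n => ?_
  change (tens V ⊗ tens V) ◁ incl V n ≫ _ = (tens V ⊗ tens V) ◁ incl V n ≫ _
  have key : ∀ {X : C} (i : X ⟶ tens V), (tens V ⊗ tens V) ◁ i ≫
      (α_ (tens V) (tens V) (tens V)).hom ≫ tens V ◁ tmul V ≫ tmul V = (α_ _ _ _).hom ≫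
        tens V ◁ (tens V ◁ i ≫ tmul V) ≫ tmul V := fun i => by simp
  induction n with
  | zero =>
    change (tens V ⊗ tens V) ◁ inclZero V ≫ _ = (tens V ⊗ tens V) ◁ inclZero V ≫ _
    rw [whisker_exchange_assoc, incl_zero_tmul, key, incl_zero_tmul]
    simp
  | succ n ih =>
    change (tens V ⊗ tens V) ◁ inclSucc V n ≫ _ = (tens V ⊗ tens V) ◁ inclSucc V n ≫ _
    rw [whisker_exchange_assoc, incl_succ_tmul, key, incl_succ_tmul]
    have e1 : tmul V ▷ (tpow V n ⊗ V) ≫ (α_ (tens V) (tpow V n) V).inv ≫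
        (tens V ◁ incl V n ≫ tmul V) ▷ V ≫ tstep V = (α_ _ _ _).inv ≫
        ((tens V ⊗ tens V) ◁ incl V n ≫ tmul V ▷ tens V ≫ tmul V) ▷ V ≫ tstep V := by
      rw [whisker_exchange_assoc]
      simp
    rw [e1, ih, key]
    simp only [MonoidalCategory.whiskerLeft_comp, Category.assoc, tstep_tmul, comp_whiskerRight]
    simp

/-- The algebra structure of the tensor algebra; its unit is the inclusion of degree zero. -/
instance (V : C) : MonObj (tens V) where
  one := inclZero V
  mul := tmul V
  one_mul := tens_one_mul V
  mul_one := incl_zero_tmul V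
  mul_assoc := tens_mul_assoc V

theorem one_tens (V : C) : (MonObj.one : 𝟙_ C ⟶ tens V) = inclZero V := rfl

theorem mul_tens (V : C) : (MonObj.mul : tens V ⊗ tens V ⟶ tens V) = tmul V := rfl

theorem tstep_liftHom {V : C} (A : C) [MonObj A] (f : V ⟶ A) :
    tstep V ≫ liftHom A f = (liftHom A f ⊗ₘ f) ≫ MonObj.mul := by
  refine extR fun n => ?_
  change incl V n ▷ V ≫ _ = incl V n ▷ V ≫ _
  rw [← Category.assoc, incl_tstep, inclSucc_liftHom]
  simp [MonoidalCategory.tensorHom_def]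

instance {V : C} (A : C) [MonObj A] (f : V ⟶ A) : IsMonHom (liftHom A f) where
  one_hom := incl_liftHom A f 0
  mul_hom := by
    rw [mul_tens]
    refine extL fun n => ?_
    change tens V ◁ incl V n ≫ _ = tens V ◁ incl V n ≫ _
    have key : ∀ {X : C} (i : X ⟶ tens V), tens V ◁ i ≫ (liftHom A f ⊗ₘ liftHom A f) ≫
        MonObj.mul = (liftHom A f ⊗ₘ (i ≫ liftHom A f)) ≫ MonObj.mul := fun i => by
      simp [MonoidalCategory.tensorHom_def']
    induction n with
    | zero =>
      change tens V ◁ inclZero V ≫ _ = tens V ◁ inclZero V ≫ _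
      rw [key, ← Category.assoc, incl_zero_tmul, inclZero_liftHom]
      simp
    | succ n ih =>
      change tens V ◁ inclSucc V n ≫ _ = tens V ◁ inclSucc V n ≫ _
      rw [key] at ih ⊢
      rw [← Category.assoc, incl_succ_tmul, Category.assoc, Category.assoc, tstep_liftHom,
        inclSucc_liftHom]
      have h1 : (tens V ◁ incl V n ≫ tmul V) ▷ V ≫ (liftHom A f ⊗ₘ f) ≫ MonObj.mul =
          ((tens V ◁ incl V n ≫ tmul V ≫ liftHom A f) ⊗ₘ f) ≫ MonObj.mul := by
        simp [MonoidalCategory.tensorHom_def]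
      have h2 : (((liftHom A f ⊗ₘ (incl V n ≫ liftHom A f)) ≫ MonObj.mul) ⊗ₘ f) ≫ MonObj.mul =
          ((liftHom A f ⊗ₘ (incl V n ≫ liftHom A f)) ⊗ₘ f) ≫ (MonObj.mul ▷ A) ≫ MonObj.mul := by
        rw [← tensorHom_id, tensorHom_comp_tensorHom_assoc, Category.comp_id]
      have h3 : (liftHom A f ⊗ₘ (((incl V n ≫ liftHom A f) ⊗ₘ f) ≫ MonObj.mul)) ≫ MonObj.mul =
          (liftHom A f ⊗ₘ ((incl V n ≫ liftHom A f) ⊗ₘ f)) ≫ (A ◁ MonObj.mul) ≫ MonObj.mul := by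
        rw [← id_tensorHom, tensorHom_comp_tensorHom_assoc, Category.comp_id]
      rw [h1, ih, h2, h3, MonObj.mul_assoc, associator_naturality_assoc, Iso.inv_hom_id_assoc]

theorem inclOne_liftHom {V : C} (A : C) [MonObj A] (f : V ⟶ A) :
    inclOne V ≫ liftHom A f = f := by
  have h : inclUnitor V ≫ liftHom A f =
      ((inclZero V ≫ liftHom A f) ⊗ₘ f) ≫ MonObj.mul := inclSucc_liftHom A f 0
  rw [inclOne, Category.assoc, h, inclZero_liftHom]
  simp

theorem monHom_ext {V A : C} [MonObj A] {f g : tens V ⟶ A} [IsMonHom f] [IsMonHom g]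
    (h : inclOne V ≫ f = inclOne V ≫ g) : f = g := by
  refine tens_ext fun n => ?_
  induction n with
  | zero => exact (IsMonHom.one_hom f).trans (IsMonHom.one_hom g).symm
  | succ n ih =>
    have e : ∀ (k : tens V ⟶ A) [IsMonHom k], inclSucc V n ≫ k =
        ((incl V n ≫ k) ⊗ₘ (inclOne V ≫ k)) ≫ MonObj.mul := fun k _ => by
      rw [inclSucc_eq, Category.assoc, ← mul_tens, IsMonHom.mul_hom]
      simp
    change inclSucc V n ≫ f = inclSucc V n ≫ g
    rw [e f, e g, ih, h]

/-- The tensor algebra `TV` as an algebra. -/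
def tensAlg (V : C) : Mon C := ⟨tens V⟩

/-- The algebra morphism `TV ⟶ A` that extends `f : V ⟶ A`. -/
def lift {V : C} {A : Mon C} (f : V ⟶ A.X) : tensAlg V ⟶ A :=
  Mon.Hom.mk' (M := tensAlg V) (N := A) (liftHom A.X f)
    (one_f := IsMonHom.one_hom (liftHom A.X f)) (mul_f := IsMonHom.mul_hom (liftHom A.X f))

/-- The inclusion of `V` into its tensor algebra. -/
def unitHom (V : C) : V ⟶ (tensAlg V).X := inclOne V

theorem unitHom_lift {V : C} {A : Mon C} (f : V ⟶ A.X) : unitHom V ≫ (lift f).hom = f :=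
  inclOne_liftHom A.X f

theorem lift_uniq {V : C} {A : Mon C} {f g : tensAlg V ⟶ A}
    (h : unitHom V ≫ f.hom = unitHom V ≫ g.hom) : f = g :=
  Mon.Hom.ext (@monHom_ext _ _ _ _ _ _ V A.X _ f.hom g.hom f.isMonHom_hom g.isMonHom_hom h)

variable (C)

/-- The tensor algebra functor `T`: on morphisms, `Tf` is the algebra morphism that extends `f`. -/
def T : C ⥤ Mon C where
  obj V := tensAlg V
  map {V W} f := lift (f ≫ unitHom W)
  map_id V := lift_uniq (by rw [unitHom_lift]; simp)
  map_comp {V W Z} f g := lift_uniq (by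
    rw [unitHom_lift, Mon.comp_hom', ← Category.assoc, unitHom_lift, Category.assoc, Category.assoc,
      unitHom_lift])

/-- The forgetful functor `Ω` from algebras to `C`. -/
abbrev Ω : Mon C ⥤ C := Mon.forget C

/-- The unit `η V = α₁ V` of the adjunction `T ⊣ Ω`. -/
def η : 𝟭 C ⟶ T C ⋙ Ω C where
  app V := unitHom V
  naturality _ W f := (unitHom_lift (f ≫ unitHom W)).symm

/-- The counit of `T ⊣ Ω`: on `A^{⊗ n}` it is the iterated multiplication of `A`. -/
def ε : Ω C ⋙ T C ⟶ 𝟭 (Mon C) where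
  app A := lift (𝟙 A.X)
  naturality A B f := by
    change lift (f.hom ≫ unitHom B.X) ≫ lift (𝟙 B.X) = lift (𝟙 A.X) ≫ f
    refine lift_uniq ?_
    rw [Mon.comp_hom', Mon.comp_hom', ← Category.assoc, unitHom_lift, Category.assoc, unitHom_lift,
      ← Category.assoc, unitHom_lift, Category.comp_id, Category.id_comp]

/-- The adjunction `T ⊣ Ω`. -/
def adj : T C ⊣ Ω C := Adjunction.mkOfUnitCounit
  { unit := η C
    counit := ε C
    left_triangle := by
      refine NatTrans.ext (funext fun V => ?_)
      simp only [NatTrans.comp_app, Functor.whiskerRight_app, Functor.associator_hom_app,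
        Functor.whiskerLeft_app, Category.id_comp]
      change lift (unitHom V ≫ unitHom (tensAlg V).X) ≫ lift (𝟙 (tensAlg V).X) = 𝟙 (tensAlg V)
      refine lift_uniq ?_
      rw [Mon.comp_hom', ← Category.assoc, unitHom_lift, Category.assoc, unitHom_lift]
      simp
    right_triangle := by
      refine NatTrans.ext (funext fun A => ?_)
      simp only [NatTrans.comp_app, Functor.whiskerRight_app, Functor.associator_inv_app,
        Functor.whiskerLeft_app, Category.id_comp]
      exact unitHom_lift (𝟙 A.X) }

variable {C} in
theorem incl_T_map {V W : C} (f : V ⟶ W) (n : ℕ) :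
    incl V n ≫ liftHom (tens W) (f ≫ inclOne W) = tpowMap f n ≫ incl W n := by
  rw [incl_liftHom]
  induction n with
  | zero => exact (Category.id_comp (inclZero W)).symm
  | succ n ih =>
    change (powLift (tens W) (f ≫ inclOne W) n ⊗ₘ (f ≫ inclOne W)) ≫ tmul W =
      (tpowMap f n ⊗ₘ f) ≫ inclSucc W n
    rw [ih, inclSucc_eq, tensorHom_comp_tensorHom_assoc]

theorem powProj_naturality [HasZeroMorphisms C] {V W : C} (f : V ⟶ W) :
    ∀ n : ℕ, tpowMap f n ≫ powProj W n = powProj V n ≫ f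
  | 0 => comp_zero.trans zero_comp.symm
  | 1 => by
    change (𝟙 (𝟙_ C) ⊗ₘ f) ≫ (λ_ W).hom = (λ_ V).hom ≫ f
    simp
  | _ + 2 => comp_zero.trans zero_comp.symm

/-- The projection `ω : ΩT ⟶ 𝟭` onto degree one. -/
def ω [HasZeroMorphisms C] : T C ⋙ Ω C ⟶ 𝟭 C where
  app V := projOne V
  naturality V W f := by
    refine tens_ext fun n => ?_
    change incl V n ≫ liftHom (tens W) (f ≫ inclOne W) ≫ projOne W =
      incl V n ≫ projOne V ≫ f
    rw [← Category.assoc, incl_T_map, ← Category.assoc (incl V n), Category.assoc]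
    have h : ∀ Z : C, incl Z n ≫ projOne Z = powProj Z n := fun Z => Sigma.ι_desc _ _
    rw [h, h, powProj_naturality]

/-! ### Augmented algebras -/

/-- The category of augmented algebras: algebras `A` with an algebra morphism to `𝟙_`. -/
abbrev AlgPlus : Type (max u v) := Over (Mon.trivial C)

/-- The functor forgetting the augmentation. -/
abbrev U : AlgPlus C ⥤ Mon C := Over.forget (Mon.trivial C)

variable {C} in
/-- The augmentation of `TV`: the algebra morphism to `𝟙_` that is zero on `V`. -/
def augT [HasZeroMorphisms C] (V : C) : tensAlg V ⟶ Mon.trivial C :=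
  lift (V := V) (A := Mon.trivial C) (0 : V ⟶ 𝟙_ C)

variable {C} in
theorem unitHom_augT [HasZeroMorphisms C] (V : C) : unitHom V ≫ (augT V).hom = 0 :=
  unitHom_lift (A := Mon.trivial C) 0

/-- The functor `T⁺` from `C` to augmented algebras, `T⁺V = (TV, ε_{TV})`. -/
def TPlus [HasZeroMorphisms C] : C ⥤ AlgPlus C where
  obj V := Over.mk (augT V)
  map {V W} f := Over.homMk ((T C).map f) (by
    change lift (f ≫ unitHom W) ≫ augT W = augT V
    refine lift_uniq ?_
    rw [Mon.comp_hom', ← Category.assoc, unitHom_lift, Category.assoc, unitHom_augT, unitHom_augT,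
      comp_zero])

variable {C} in
/-- The morphism `Ωε : ΩA ⟶ 𝟙_` underlying the augmentation. -/
def aug (A : AlgPlus C) : A.left.X ⟶ 𝟙_ C := A.hom.hom

variable {C} in
theorem map_aug {A B : AlgPlus C} (f : A ⟶ B) : f.left.hom ≫ aug B = aug A :=
  congrArg Mon.Hom.hom (Over.w f)

/-- The augmentation ideal functor `Ω⁺`, `Ω⁺(A, ε) = Ker (Ωε)`. -/
def ΩPlus [HasZeroMorphisms C] [HasKernels C] : AlgPlus C ⥤ C where
  obj A := kernel (aug A)
  map {A B} f := kernel.lift (aug B) (kernel.ι (aug A) ≫ f.left.hom) (by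
    rw [Category.assoc, map_aug, kernel.condition])

variable {C} in
/-- The inclusion `k A : Ω⁺ A ⟶ Ω A` of the augmentation ideal. -/
def k [HasZeroMorphisms C] [HasKernels C] (A : AlgPlus C) : (ΩPlus C).obj A ⟶ A.left.X :=
  kernel.ι (aug A)

variable {C} in
theorem k_ext [HasZeroMorphisms C] [HasKernels C] {X : C} {A : AlgPlus C}
    {f g : X ⟶ (ΩPlus C).obj A} (h : f ≫ k A = g ≫ k A) : f = g :=
  (cancel_mono (kernel.ι (aug A))).1 h

variable {C} in
theorem k_aug [HasZeroMorphisms C] [HasKernels C] (A : AlgPlus C) : k A ≫ aug A = 0 :=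
  kernel.condition (aug A)

variable {C} in
theorem map_k [HasZeroMorphisms C] [HasKernels C] {A B : AlgPlus C} (f : A ⟶ B) :
    (ΩPlus C).map f ≫ k B = k A ≫ f.left.hom := kernel.lift_ι (aug B) _ _

variable {C} in
/-- The component of `η⁺` at `V`, determined by `k(T⁺V) ∘ η⁺V = ηV`. -/
def ηPlusApp [HasZeroMorphisms C] [HasKernels C] (V : C) : V ⟶ (ΩPlus C).obj ((TPlus C).obj V) :=
  kernel.lift (aug ((TPlus C).obj V)) (unitHom V) (unitHom_augT V)

variable {C} in
theorem ηPlusApp_k [HasZeroMorphisms C] [HasKernels C] (V : C) :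
    ηPlusApp V ≫ k ((TPlus C).obj V) = unitHom V :=
  kernel.lift_ι (aug ((TPlus C).obj V)) _ _

/-- The unit of `T⁺ ⊣ Ω⁺`. -/
def ηPlus [HasZeroMorphisms C] [HasKernels C] : 𝟭 C ⟶ TPlus C ⋙ ΩPlus C where
  app V := ηPlusApp V
  naturality V W f := by
    change f ≫ ηPlusApp W = ηPlusApp V ≫ (ΩPlus C).map ((TPlus C).map f)
    refine k_ext ?_
    rw [Category.assoc, ηPlusApp_k, Category.assoc, map_k, ← Category.assoc, ηPlusApp_k]
    exact (unitHom_lift (f ≫ unitHom W)).symm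

variable {C} in
/-- The algebra morphism `εA ∘ T(kA) : TΩ⁺A ⟶ A`. -/
def evalK [HasZeroMorphisms C] [HasKernels C] (A : AlgPlus C) :
    tensAlg ((ΩPlus C).obj A) ⟶ A.left :=
  (T C).map (k A) ≫ (ε C).app A.left

variable {C} in
theorem unitHom_evalK [HasZeroMorphisms C] [HasKernels C] (A : AlgPlus C) :
    unitHom ((ΩPlus C).obj A) ≫ (evalK A).hom = k A := by
  change unitHom ((ΩPlus C).obj A) ≫ (lift (k A ≫ unitHom A.left.X)).hom ≫
    (lift (𝟙 A.left.X)).hom = k A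
  rw [← Category.assoc, unitHom_lift, Category.assoc, unitHom_lift, Category.comp_id]

/-- The counit of `T⁺ ⊣ Ω⁺`: its underlying algebra morphism is `εA ∘ T(kA)`. -/
def εPlus [HasZeroMorphisms C] [HasKernels C] : ΩPlus C ⋙ TPlus C ⟶ 𝟭 (AlgPlus C) where
  app A := Over.homMk (evalK A) (by
    change evalK A ≫ A.hom = augT ((ΩPlus C).obj A)
    refine lift_uniq ?_
    change unitHom _ ≫ (evalK A).hom ≫ aug A = _
    rw [← Category.assoc, unitHom_evalK, k_aug]
    exact (unitHom_augT ((ΩPlus C).obj A)).symm)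
  naturality A B f := by
    refine Over.OverMorphism.ext ?_
    change lift ((ΩPlus C).map f ≫ unitHom _) ≫ evalK B = evalK A ≫ f.left
    refine lift_uniq ?_
    rw [Mon.comp_hom', Mon.comp_hom', ← Category.assoc, unitHom_lift, Category.assoc,
      unitHom_evalK, ← Category.assoc, unitHom_evalK, map_k]

/-- The adjunction `T⁺ ⊣ Ω⁺`. -/
def adjPlus [HasZeroMorphisms C] [HasKernels C] : TPlus C ⊣ ΩPlus C :=
  Adjunction.mkOfUnitCounit
  { unit := ηPlus C
    counit := εPlus C
    left_triangle := by
      refine NatTrans.ext (funext fun V => ?_)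
      simp only [NatTrans.comp_app, Functor.whiskerRight_app, Functor.associator_hom_app,
        Functor.whiskerLeft_app, Category.id_comp]
      refine Over.OverMorphism.ext ?_
      change lift (ηPlusApp V ≫ unitHom _) ≫ evalK ((TPlus C).obj V) = 𝟙 (tensAlg V)
      refine lift_uniq ?_
      rw [Mon.comp_hom', ← Category.assoc, unitHom_lift, Category.assoc, unitHom_evalK, ηPlusApp_k]
      exact (Category.comp_id (unitHom V)).symm
    right_triangle := by
      refine NatTrans.ext (funext fun A => ?_)
      simp only [NatTrans.comp_app, Functor.whiskerRight_app, Functor.associator_inv_app,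
        Functor.whiskerLeft_app, Category.id_comp]
      change ηPlusApp ((ΩPlus C).obj A) ≫ (ΩPlus C).map ((εPlus C).app A) = 𝟙 ((ΩPlus C).obj A)
      refine k_ext ?_
      rw [Category.assoc, map_k, ← Category.assoc, ηPlusApp_k, Category.id_comp]
      exact unitHom_evalK A }

/-- The natural transformation `ζ : Ω⁺ ⟶ ΩU`, the composite of `ηΩ⁺ : Ω⁺ ⟶ ΩTΩ⁺ = ΩUT⁺Ω⁺` and
`ΩUε⁺ : ΩUT⁺Ω⁺ ⟶ ΩU`. -/
def ζ [HasZeroMorphisms C] [HasKernels C] : ΩPlus C ⟶ U C ⋙ Ω C :=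
  (show ΩPlus C ⟶ (ΩPlus C ⋙ TPlus C) ⋙ U C ⋙ Ω C from Functor.whiskerLeft (ΩPlus C) (η C)) ≫
    Functor.whiskerRight (εPlus C) (U C ⋙ Ω C)

/-- The natural transformation `ζT⁺ : Ω⁺T⁺ ⟶ ΩUT⁺ = ΩT`. -/
def ζT [HasZeroMorphisms C] [HasKernels C] : TPlus C ⋙ ΩPlus C ⟶ T C ⋙ Ω C :=
  Functor.whiskerLeft (TPlus C) (ζ C)

/-- The natural transformation `ω⁺ = ω ∘ ζT⁺ : Ω⁺T⁺ ⟶ 𝟭`. -/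
def ωPlus [HasZeroMorphisms C] [HasKernels C] : TPlus C ⋙ ΩPlus C ⟶ 𝟭 C := ζT C ≫ ω C

end TensorAlgebra

/-! ### Augmentations of monads and h-separable functors -/

section Sep

universe v' u'

variable {B : Type u} [Category.{v} B] {A : Type u'} [Category.{v'} A]

/-- An augmentation of a monad `(M, m, e)`: a natural transformation `γ : M ⟶ 𝟭` such that
`γ ∘ e = 𝟙` and `γ ∘ m = γγ`, where `γγ : MM ⟶ 𝟭` is the horizontal composite, whose
component at `X` is `γ X ∘ γ (M X)`. -/
structure IsAugmentation (M : Monad B) (γ : M.toFunctor ⟶ 𝟭 B) : Prop where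
  unit : ∀ X : B, M.η.app X ≫ γ.app X = 𝟙 X
  mul : ∀ X : B, M.μ.app X ≫ γ.app X = γ.app (M.obj X) ≫ γ.app X

/-- The data that make `L : B ⥤ A` an h-separable (heavily separable) functor: maps
`P : Hom(LX, LY) → Hom(X, Y)`, natural in `X` and `Y`, that are left inverse to the action of `L`
on morphisms and are compatible with composition. -/
structure IsHSeparation (L : B ⥤ A) (P : ∀ X Y : B, (L.obj X ⟶ L.obj Y) → (X ⟶ Y)) : Prop where
  natural : ∀ {X' X Y Y' : B} (a : X' ⟶ X) (f : L.obj X ⟶ L.obj Y) (b : Y ⟶ Y'),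
    P X' Y' (L.map a ≫ f ≫ L.map b) = a ≫ P X Y f ≫ b
  split : ∀ {X Y : B} (f : X ⟶ Y), P X Y (L.map f) = f
  comp : ∀ {X Y Z : B} (f : L.obj X ⟶ L.obj Y) (g : L.obj Y ⟶ L.obj Z),
    P X Z (f ≫ g) = P X Y f ≫ P Y Z g

/-- `L` is h-separable. -/
def IsHSeparable (L : B ⥤ A) : Prop :=
  ∃ P : ∀ X Y : B, (L.obj X ⟶ L.obj Y) → (X ⟶ Y), IsHSeparation L P

end Sep

end TensorAlg

end

/-! Write p₀ and p₁ for the projections of TV onto degrees zero and one. Since p₀ is the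
augmentation of T⁺V, the object Ω⁺T⁺V is the kernel of p₀.

By the triangle identity, `ζ` at A is just the inclusion kA. Both composites in the multiplicativity
square of ζT⁺ are therefore a kernel inclusion followed by the algebra morphism that extends `kTens
V`; this makes ζT⁺ a morphism of monads.

For ω⁺ = p₁ ∘ k, the unit law is p₁ ∘ α₁ = id. Multiplicativity rests on the derivation rule p₁(xy)
= p₁(x)p₀(y) + p₀(x)p₁(y) (`tmul_projOne`): a product of two or more elements of Ker p₀ has no
degree one part, and neither does the empty product. So multiplying a formal word in Ker p₀ and then
taking p₁ sees only the part of the word of length one (`liftHom_projOne`), which is the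
augmentation law. On all of TV this fails, since 1·v = v; restricting ω to the kernel is essential.

h-separability then follows from a fact about any adjunction L ⊣ R: under P(f) = γ ∘ Rf ∘ η,
multiplicativity of γ corresponds to compatibility of P with composition
(`isAugmentation_iff_isHSeparation`). -/

namespace TensorAlg

universe v u v' u'

/-! ### Augmentations of the monad of an adjunction and h-separability -/

section HSeparability

variable {B : Type u} [Category.{v} B] {A : Type u'} [Category.{v'} A]

/-- For an adjunction `L ⊣ R`, a natural transformation `γ : LR ⟶ 𝟭` is an augmentation of the
associated monad if and only if the corresponding maps `Hom(LX, LY) → Hom(X, Y)` make `L`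
h-separable. -/
theorem isAugmentation_iff_isHSeparation {L : B ⥤ A} {R : A ⥤ B} (adj : L ⊣ R)
    (γ : L ⋙ R ⟶ 𝟭 B) :
    IsAugmentation adj.toMonad γ ↔
      IsHSeparation L fun X Y f => adj.unit.app X ≫ R.map f ≫ γ.app Y := by
  have nat : ∀ {X Y : B} (h : X ⟶ Y), R.map (L.map h) ≫ γ.app Y = γ.app X ≫ h :=
    fun h => γ.naturality h
  constructor
  · rintro ⟨h_unit, h_mul⟩
    have unit : ∀ X : B, adj.unit.app X ≫ γ.app X = 𝟙 X := h_unit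
    have mul : ∀ X : B, R.map (adj.counit.app (L.obj X)) ≫ γ.app X =
        γ.app (R.obj (L.obj X)) ≫ γ.app X := h_mul
    refine ⟨fun {X' X Y Y'} a f b => ?_, fun {X Y} f => ?_, fun {X Y Z} f g => ?_⟩
    · have ha : adj.unit.app X' ≫ R.map (L.map a) = a ≫ adj.unit.app X :=
        (adj.unit.naturality a).symm
      simp only [Functor.map_comp, Category.assoc]
      rw [nat b, reassoc_of% ha]
    · have hf : adj.unit.app X ≫ R.map (L.map f) = f ≫ adj.unit.app Y :=
        (adj.unit.naturality f).symm
      rw [reassoc_of% hf, unit, Category.comp_id]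
    -- Naturality of γ moves `γ.app Y` to the far right, where multiplicativity turns the two copies
    -- of γ into the monad multiplication. The counit then slides past `g` and cancels the unit by
    -- the left triangle identity.
    · have key : γ.app Y ≫ adj.unit.app Y ≫ R.map g ≫ γ.app Z = R.map g ≫ γ.app Z := by
        rw [← nat]
        simp only [Functor.map_comp, Category.assoc]
        rw [nat (γ.app Z)]
        change _ ≫ _ ≫ γ.app (R.obj (L.obj Z)) ≫ γ.app Z = _
        rw [← mul, ← R.map_comp_assoc (L.map (R.map g)),
          show L.map (R.map g) ≫ adj.counit.app (L.obj Z) = adj.counit.app (L.obj Y) ≫ g from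
            adj.counit.naturality g,
          ← R.map_comp_assoc, adj.left_triangle_components_assoc]
      simp only [Functor.map_comp, Category.assoc]
      rw [key]
  · intro h
    refine ⟨fun X => ?_, fun X => ?_⟩
    · have := h.split (𝟙 X)
      rw [L.map_id, R.map_id] at this
      exact (congrArg (adj.unit.app X ≫ ·) (Category.id_comp (γ.app X)).symm).trans this
    -- For these two counits every unit meets the image under `R` of a counit and cancels by the
    -- right triangle identity. What remains of compatibility with composition is exactly the
    -- multiplication law.
    · have := h.comp (adj.counit.app (L.obj (R.obj (L.obj X)))) (adj.counit.app (L.obj X))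
      simp only [Functor.map_comp, Category.assoc, adj.right_triangle_components_assoc] at this
      exact this

end HSeparability

/-! ### Degree zero and degree one parts of products in the tensor algebra -/

section DegreeOne

variable {C : Type u} [Category.{v} C] [MonoidalCategory C] [HasCoproductsOfShape ℕ C]

theorem inclUnitor_projOne [HasZeroMorphisms C] (V : C) :
    inclUnitor V ≫ projOne V = (λ_ V).hom := Sigma.ι_desc (powProj V) 1

theorem inclZero_projOne [HasZeroMorphisms C] (V : C) : inclZero V ≫ projOne V = 0 :=
  Sigma.ι_desc (powProj V) 0

theorem inclSucc_succ_projOne [HasZeroMorphisms C] (V : C) (n : ℕ) :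
    inclSucc V (n + 1) ≫ projOne V = 0 := Sigma.ι_desc (powProj V) (n + 2)

theorem inclOne_projOne [HasZeroMorphisms C] (V : C) : inclOne V ≫ projOne V = 𝟙 V := by
  rw [inclOne, Category.assoc, inclUnitor_projOne, Iso.inv_hom_id]

variable [Preadditive C]

/-- The projection of the tensor algebra onto degree zero. -/
noncomputable abbrev projZero (V : C) : tens V ⟶ 𝟙_ C := liftHom (𝟙_ C) (0 : V ⟶ 𝟙_ C)

theorem inclZero_projZero (V : C) : inclZero V ≫ projZero V = 𝟙 (𝟙_ C) :=
  inclZero_liftHom (𝟙_ C) 0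

theorem inclSucc_projZero [MonoidalPreadditive C] (V : C) (n : ℕ) : inclSucc V n ≫ projZero V = 0 := by
  rw [inclSucc_liftHom, MonoidalPreadditive.tensor_zero, zero_comp]

variable [∀ X : C, PreservesColimitsOfShape (Discrete ℕ) (tensorLeft X)]
  [∀ X : C, PreservesColimitsOfShape (Discrete ℕ) (tensorRight X)]

theorem tmul_projZero (V : C) :
    tmul V ≫ projZero V = (projZero V ⊗ₘ projZero V) ≫ (λ_ (𝟙_ C)).hom :=
  IsMonHom.mul_hom (projZero V)

variable [MonoidalPreadditive C]

/-- A word wv with v in V has length one exactly when w has length zero. -/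
theorem tstep_projOne (V : C) : tstep V ≫ projOne V = projZero V ▷ V ≫ (λ_ V).hom := by
  refine extR fun n => ?_
  change incl V n ▷ V ≫ _ = incl V n ▷ V ≫ _
  rw [← Category.assoc, incl_tstep, ← comp_whiskerRight_assoc]
  cases n with
  | zero =>
    change inclUnitor V ≫ _ = (inclZero V ≫ _) ▷ V ≫ _
    rw [inclUnitor_projOne, inclZero_projZero, id_whiskerRight, Category.id_comp]
  | succ n =>
    change _ = (inclSucc V n ≫ _) ▷ V ≫ _
    rw [inclSucc_succ_projOne, inclSucc_projZero, MonoidalPreadditive.zero_whiskerRight]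
    exact zero_comp.symm

/-- The projection onto degree one is a derivation along the projection onto degree zero. -/
theorem tmul_projOne (V : C) : tmul V ≫ projOne V =
    (projOne V ⊗ₘ projZero V) ≫ (ρ_ V).hom + (projZero V ⊗ₘ projOne V) ≫ (λ_ V).hom := by
  refine extL fun n => ?_
  change tens V ◁ incl V n ≫ _ = tens V ◁ incl V n ≫ _
  have key : ∀ {X : C} (i : X ⟶ tens V), tens V ◁ i ≫ ((projOne V ⊗ₘ projZero V) ≫ (ρ_ V).hom +
      (projZero V ⊗ₘ projOne V) ≫ (λ_ V).hom) = (projOne V ⊗ₘ (i ≫ projZero V)) ≫ (ρ_ V).hom +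
      (projZero V ⊗ₘ (i ≫ projOne V)) ≫ (λ_ V).hom := fun i => by
    simp [MonoidalCategory.tensorHom_def']
  cases n with
  | zero =>
    refine Eq.trans ?_ (key (inclZero V)).symm
    change tens V ◁ inclZero V ≫ _ = _
    rw [← Category.assoc, incl_zero_tmul, inclZero_projZero, inclZero_projOne,
      MonoidalPreadditive.tensor_zero, zero_comp, add_zero, tensorHom_id, rightUnitor_naturality]
  -- A right factor of positive length has the form wv, and x(wv) = (xw)v. Its degree one part is
  -- p₀(xw)v = p₀(x)p₀(w)v, because p₀ is multiplicative; no induction on the length is needed. The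
  -- other summand vanishes since p₀(wv) = 0.
  | succ n =>
    refine Eq.trans ?_ (key (inclSucc V n)).symm
    change tens V ◁ inclSucc V n ≫ _ = _
    rw [← Category.assoc, incl_succ_tmul, inclSucc_projZero, MonoidalPreadditive.tensor_zero,
      zero_comp, zero_add, ← incl_tstep, Category.assoc, Category.assoc, Category.assoc,
      tstep_projOne, ← comp_whiskerRight_assoc, Category.assoc, tmul_projZero]
    simp [MonoidalCategory.tensorHom_def']

variable {V W : C} (f : W ⟶ tens V)

/-- p₀ is multiplicative and kills the last factor of the product. -/
theorem inclSucc_liftHom_projZero (hf : f ≫ projZero V = 0) (n : ℕ) :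
    inclSucc W n ≫ liftHom (tens V) f ≫ projZero V = 0 := by
  rw [← Category.assoc, inclSucc_liftHom, Category.assoc, mul_tens, tmul_projZero,
    tensorHom_comp_tensorHom_assoc, hf, MonoidalPreadditive.tensor_zero, zero_comp]

/-- If `f : W ⟶ ΩTV` has no component in degree zero, then the degree one part of the algebra
morphism `TW ⟶ TV` extending `f` only depends on the degree one part of its argument. -/
theorem liftHom_projOne (hf : f ≫ projZero V = 0) :
    liftHom (tens V) f ≫ projOne V = projOne W ≫ f ≫ projOne V := by
  refine tens_ext fun n => ?_
  match n with
  | 0 =>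
    change inclZero W ≫ _ = inclZero W ≫ _
    rw [← Category.assoc, inclZero_liftHom, one_tens, inclZero_projOne, ← Category.assoc,
      inclZero_projOne, zero_comp]
  | 1 =>
    change inclUnitor W ≫ _ = inclUnitor W ≫ _
    refine (cancel_epi (λ_ W).inv).1 ?_
    refine (Category.assoc _ _ _).symm.trans (Eq.trans ?_ (Category.assoc _ _ _))
    change inclOne W ≫ _ = inclOne W ≫ _
    rw [← Category.assoc, ← Category.assoc, inclOne_liftHom, inclOne_projOne, Category.id_comp]
  -- Split off the last letter and apply the derivation rule. One summand contains p₀ ∘ f = 0; the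
  -- other contains p₀ of the product over the first n + 1 letters, zero because that prefix is
  -- nonempty. In length one the prefix is the unit, so that case is separate.
  | n + 2 =>
    change inclSucc W (n + 1) ≫ _ = inclSucc W (n + 1) ≫ _
    rw [← Category.assoc (inclSucc W (n + 1)) (projOne W), inclSucc_succ_projOne, zero_comp,
      ← Category.assoc, inclSucc_liftHom, Category.assoc, mul_tens, tmul_projOne,
      Preadditive.comp_add, tensorHom_comp_tensorHom_assoc, tensorHom_comp_tensorHom_assoc, hf,
      MonoidalPreadditive.tensor_zero, zero_comp, zero_add, Category.assoc]
    have : incl W (n + 1) ≫ liftHom (tens V) f ≫ projZero V = 0 :=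
      inclSucc_liftHom_projZero f hf n
    rw [this, MonoidalPreadditive.zero_tensor, zero_comp]

end DegreeOne

/-! ### The monad morphism ζT⁺ and the augmentation ω⁺ -/

section Augmentation

variable (C : Type u) [Category.{v} C] [MonoidalCategory C] [HasCoproductsOfShape ℕ C]
  [∀ X : C, PreservesColimitsOfShape (Discrete ℕ) (tensorLeft X)]
  [∀ X : C, PreservesColimitsOfShape (Discrete ℕ) (tensorRight X)]

variable {C} in
-- Both sides are algebra morphisms that restrict to `f` on `W`.
theorem liftHom_comp_inclOne_liftHom_id {V W : C} (f : W ⟶ tens V) :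
    liftHom (tens (tens V)) (f ≫ inclOne (tens V)) ≫ liftHom (tens V) (𝟙 (tens V)) =
      liftHom (tens V) f :=
  monHom_ext (by
    rw [← Category.assoc, inclOne_liftHom, Category.assoc, inclOne_liftHom, inclOne_liftHom,
      Category.comp_id])

/-- The component of `ζ` at `A` is the inclusion of the augmentation ideal of `A`. -/
theorem ζ_app [HasZeroMorphisms C] [HasKernels C] (A : AlgPlus C) : (ζ C).app A = k A :=
  unitHom_evalK A

section

variable [HasZeroMorphisms C] [HasKernels C]

variable {C} in
/-- The inclusion of the augmentation ideal of the tensor algebra of `V`. -/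
noncomputable abbrev kTens (V : C) : (ΩPlus C).obj ((TPlus C).obj V) ⟶ tens V :=
  k ((TPlus C).obj V)

theorem ζT_app (V : C) : (ζT C).app V = kTens V :=
  ζ_app C ((TPlus C).obj V)

variable {C} in
theorem ηPlusApp_kTens (V : C) : ηPlusApp V ≫ kTens V = inclOne V :=
  ηPlusApp_k V

variable {C} in
theorem map_map_kTens {V W : C} (f : V ⟶ W) :
    (ΩPlus C).map ((TPlus C).map f) ≫ kTens W =
      kTens V ≫ liftHom (tens W) (f ≫ inclOne W) :=
  map_k ((TPlus C).map f)

variable {C} in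
-- The counit at T⁺V is the unique algebra morphism extending `kTens V`, and k is natural. This
-- computes the multiplication of the monad Ω⁺T⁺ inside TV.
theorem map_εPlus_kTens (V : C) :
    (ΩPlus C).map ((εPlus C).app ((TPlus C).obj V)) ≫ kTens V =
      kTens ((ΩPlus C).obj ((TPlus C).obj V)) ≫ liftHom (tens V) (kTens V) := by
  have h : evalK ((TPlus C).obj V) = lift (A := tensAlg V) (kTens V) :=
    lift_uniq ((unitHom_evalK _).trans (unitHom_lift (A := tensAlg V) _).symm)
  exact (map_k _).trans (congrArg (fun t => k _ ≫ t) (congrArg Mon.Hom.hom h))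

/-- `ζT⁺` as a morphism of monads. -/
noncomputable def ζTMonadHom : (adjPlus C).toMonad ⟶ (adj C).toMonad :=
  show MonadHom _ _ from
  { toNatTrans := ζT C
    app_η := fun V => by
      rw [ζT_app]
      exact ηPlusApp_k V
    app_μ := fun V => by
      rw [ζT_app, ζT_app]
      -- Each side reduces to the kernel inclusion followed by `liftHom (tens V) (kTens V)`.
      change (ΩPlus C).map ((εPlus C).app ((TPlus C).obj V)) ≫ kTens V =
        ((ΩPlus C).map ((TPlus C).map (kTens V)) ≫ kTens (tens V)) ≫
          liftHom (tens V) (𝟙 (tens V))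
      rw [map_εPlus_kTens, map_map_kTens, Category.assoc, liftHom_comp_inclOne_liftHom_id] }

end

/-- `liftHom_projOne` applied to f = `kTens V` is the multiplication law before restriction along
the outer kernel inclusion. -/
theorem isAugmentation_ωPlus [Preadditive C] [MonoidalPreadditive C] [HasKernels C] :
    IsAugmentation (adjPlus C).toMonad (ωPlus C) := by
  have hω : ∀ V : C, (ωPlus C).app V = kTens V ≫ projOne V := fun V =>
    congrArg (· ≫ projOne V) (ζT_app C V)
  refine ⟨fun V => ?_, fun V => ?_⟩
  · rw [hω]
    change ηPlusApp V ≫ kTens V ≫ projOne V = 𝟙 V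
    rw [← Category.assoc, ηPlusApp_kTens, inclOne_projOne]
  · rw [hω]
    change (ΩPlus C).map ((εPlus C).app ((TPlus C).obj V)) ≫ kTens V ≫ projOne V =
      (ωPlus C).app ((ΩPlus C).obj ((TPlus C).obj V)) ≫ kTens V ≫ projOne V
    -- `k_aug` supplies the hypothesis on degree zero, because `projZero V` is by definition the
    -- morphism underlying the augmentation of T⁺V.
    rw [hω, ← Category.assoc, map_εPlus_kTens, Category.assoc, Category.assoc,
      liftHom_projOne (kTens V) (k_aug ((TPlus C).obj V))]

end Augmentation

end TensorAlg

theorem mainTheorem10 {M : Type*} [Category* M] [Preadditive M] [MonoidalCategory M]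
    [BraidedCategory M] [MonoidalPreadditive M]
    [HasEqualizers M] [HasCoproductsOfShape ℕ M] [HasReflexiveCoequalizers M]
    [∀ X : M, PreservesLimitsOfShape WalkingParallelPair (tensorLeft X)]
    [∀ X : M, PreservesLimitsOfShape WalkingParallelPair (tensorRight X)]
    [∀ X : M, PreservesColimitsOfShape (Discrete ℕ) (tensorLeft X)]
    [∀ X : M, PreservesColimitsOfShape (Discrete ℕ) (tensorRight X)]
    [∀ X : M, Monad.PreservesColimitOfIsReflexivePair (tensorLeft X)]
    [∀ X : M, Monad.PreservesColimitOfIsReflexivePair (tensorRight X)] :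
    (∃ φ : (TensorAlg.adjPlus M).toMonad ⟶ (TensorAlg.adj M).toMonad, φ.toNatTrans = TensorAlg.ζT M) ∧
    TensorAlg.IsAugmentation (TensorAlg.adjPlus M).toMonad (TensorAlg.ωPlus M) ∧
    TensorAlg.IsHSeparable (TensorAlg.TPlus M) ∧
    (∀ γ : TensorAlg.TPlus M ⋙ TensorAlg.ΩPlus M ⟶ 𝟭 M,
      TensorAlg.IsAugmentation (TensorAlg.adjPlus M).toMonad γ ↔
        TensorAlg.IsHSeparation (TensorAlg.TPlus M) fun X Y f =>
          (TensorAlg.adjPlus M).unit.app X ≫ (TensorAlg.ΩPlus M).map f ≫ γ.app Y) := by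
  have h := TensorAlg.isAugmentation_ωPlus M
  have hiff := TensorAlg.isAugmentation_iff_isHSeparation (TensorAlg.adjPlus M)
  exact ⟨⟨TensorAlg.ζTMonadHom M, rfl⟩, h, ⟨_, (hiff _).1 h⟩, hiff⟩
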